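/- Let $\mathcal H$ be a complex Hilbert space (of arbitrary, possibly infinite, dimension), let $|\psi\rangle\in\mathcal H$ be a unit vector, and let $A_i$, $B_i$ $(i\in\{1,2,3\})$ and $M_{ij}=M_{ji}$ $(i\neq j\in\{1,2,3\})$ be $\pm1$-valued projective observables on $\mathcal H$, i.e. bounded self-adjoint operators with $A_i^2=B_i^2=M_{ij}^2=\mathbb 1$. No commutation relations between them are assumed. For observables $C_1,\dots,C_n$ measured projectively in the order $C_1\to C_2\to\dots\to C_n$ on $|\psi\rangle$ let $$\langle C_1\cdots C_n\rangle_{seq}=\sum_{c_1,\dots,c_n=\pm1}c_1\cdots c_n\,\Big\|\tfrac{\mathbb 1+c_nC_n}{2}\cdots\tfrac{\mathbb 1+c_1C_1}{2}|\psi\rangle\Big\|^2$$ be the expected product of the outcomes; it equals $2^{-(n-1)}\langle\psi|\{C_1,\{C_2,\dots,\{C_{n-1},C_n\}\}\}|\psi\rangle$. Let $\langle C_1\cdots C_n\rangle_\pi$ be the average of $\langle C_{\sigma(1)}\cdots C_{\sigma(n)}\rangle_{seq}$ over a set $S$ of permutations $\sigma$ such that each of the $n!$ products $C_{\tau(1)}\cdots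 C_{\tau(n)}$ occurs in the expansion of at least one of the corresponding nested anticommutators (for example, $\langle C_1C_2\rangle_\pi=\langle C_1C_2\rangle_{seq}$ and $\langle C_1C_2C_3\rangle_\pi=\frac12(\langle C_1C_2C_3\rangle_{seq}+\langle C_2C_1C_3\rangle_{seq})$). The set $S$ is arbitrary with this property and may be chosen separately for each correlator. Put $$\begin{aligned}T_3={}&\langle A_1A_2B_3M_{12}\rangle_\pi+\langle A_3A_1B_2M_{31}\rangle_\pi+\langle A_2A_3B_1M_{23}\rangle_\pi+\langle A_1B_2B_3\rangle_\pi+\langle B_1A_2B_3\rangle_\pi+\langle B_1B_2A_3\rangle_\pi\\&-\langle A_1A_2A_3\rangle_\pi+\langle M_{23}M_{31}\rangle_\pi+\langle M_{31}M_{12}\rangle_\pi+\langle M_{23}M_{12}\rangle_\pi .\end{aligned}$$ Suppose that $T_3$ takes its maximal value $10$. Then the subspace $$V_3=\mathrm{span}\{|\psi\rangle,A_1|\psi\rangle,A_2|\psi\rangle,A_3|\psi\rangle,B_1|\psi\rangle,B_2|\psi\rangle,B_3|\psi\rangle,A_1B_1|\psi\rangle\}$$ has dimension $8$ and is invariant under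 all $A_i$, $B_i$ and $M_{ij}$. Moreover, with $P:\mathcal H\to V_3$ the orthogonal projection onto $V_3$ (so that $P^\dagger$ is the inclusion $V_3\hookrightarrow\mathcal H$), there is a unitary $U:V_3\to(\mathbb C^2)^{\otimes3}$ such that, for all $i$ and for all $i\neq j$ with $k$ the third index, $$U(PA_iP^\dagger)U^\dagger=X_i,\qquad U(PB_iP^\dagger)U^\dagger=Z_i,\qquad U(PM_{ij}P^\dagger)U^\dagger=X_iX_jZ_k,\qquad U(P|\psi\rangle)=|G_3\rangle,$$ where $X_i,Z_i$ are the Pauli operators on the $i$-th qubit and $$|G_3\rangle=\tfrac1{\sqrt8}\big(|000\rangle+|100\rangle+|010\rangle-|110\rangle+|001\rangle-|101\rangle-|011\rangle-|111\rangle\big)$$ is the three-qubit complete-graph state. -/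

import Mathlib

namespace TemporalSelfTest

noncomputable section

section Sequential

variable {H : Type*} [NormedAddCommGroup H] [InnerProductSpace ℂ H]

/-- A projective measurement with outcomes `±1`, encoded by its observable: a self-adjoint bounded
operator that squares to the identity. -/
def IsDichotomic [CompleteSpace H] (M : H →L[ℂ] H) : Prop :=
  IsSelfAdjoint M ∧ M * M = 1

/-- The projector `(1 + m M) / 2` onto the eigenspace of `M` for the outcome `m = ±1`. -/
def outcomeProj (M : H →L[ℂ] H) (m : ℤˣ) : H →L[ℂ] H :=
  (1 / 2 : ℂ) • (1 + (m : ℤ) • M)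

/-- The unnormalized state left after measuring `M 0 → M 1 → ⋯ → M (n-1)`, in this order, on `ψ`
with outcomes `m 0, …, m (n-1)`. -/
def postState {n : ℕ} (M : Fin n → (H →L[ℂ] H)) (m : Fin n → ℤˣ) (ψ : H) : H :=
  (List.ofFn fun i => outcomeProj (M i) (m i)).foldl (fun φ Q => Q φ) ψ

/-- Born's rule: the joint probability of the outcomes `m` of the sequence `M 0 → ⋯ → M (n-1)`. -/
def outcomeProb {n : ℕ} (M : Fin n → (H →L[ℂ] H)) (m : Fin n → ℤˣ) (ψ : H) : ℝ :=
  ‖postState M m ψ‖ ^ 2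

/-- The sequential correlation `⟨M 0 ⋯ M (n-1)⟩_seq`: the expectation of the product of the outcomes
of the measurements performed in the order `M 0 → ⋯ → M (n-1)`. -/
def seqCorr {n : ℕ} (M : Fin n → (H →L[ℂ] H)) (ψ : H) : ℝ :=
  ∑ m : Fin n → ℤˣ, (∏ i, ((m i : ℤ) : ℝ)) * outcomeProb M m ψ

/-- The monomials that occur in the nested anticommutator `{a₁, {a₂, …, {aₙ₋₁, aₙ}}}`, that is, the
products whose expectation values occur in the sequential correlation for `a₁ → ⋯ → aₙ`. -/
def seqWords {α : Type*} : List α → List (List α)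
  | [] => [[]]
  | a :: l => (seqWords l).map (fun w => a :: w) ++ (seqWords l).map (fun w => w ++ [a])

/-- A set of measurement orders is complete if each of the `n!` permutations of the product of the
`n` observables occurs in at least one of the corresponding sequential correlations. -/
def CoversAllOrders {n : ℕ} (S : Finset (Equiv.Perm (Fin n))) : Prop :=
  ∀ τ : Equiv.Perm (Fin n), ∃ σ ∈ S, List.ofFn τ ∈ seqWords (List.ofFn σ)

/-- A complete set of orders in which `n` measurements are performed. -/
abbrev OrderSet (n : ℕ) : Type := {S : Finset (Equiv.Perm (Fin n)) // CoversAllOrders S}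

/-- For two measurements the single order `M₁ → M₂` is complete. -/
theorem coversAllOrders_two : CoversAllOrders ({1} : Finset (Equiv.Perm (Fin 2))) := by
  unfold CoversAllOrders; decide

/-- For three measurements the orders `M₁ → M₂ → M₃` and `M₂ → M₁ → M₃` are complete. -/
theorem coversAllOrders_three :
    CoversAllOrders ({1, Equiv.swap 0 1} : Finset (Equiv.Perm (Fin 3))) := by
  unfold CoversAllOrders; decide

/-- `⟨M 0 ⋯ M (n-1)⟩_π`: the average of the sequential correlations over the orders in `S`. -/
def permCorr {n : ℕ} (S : OrderSet n) (M : Fin n → (H →L[ℂ] H)) (ψ : H) : ℝ :=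
  (S.1.card : ℝ)⁻¹ * ∑ σ ∈ S.1, seqCorr (fun i => M (σ i)) ψ

/-- The temporal expression `T₃`; the indices `1, 2, 3` are written `0, 1, 2`. The arguments
`π₄, π₃, π₂` are the sets of orders used for each correlator of four, three and two observables. -/
def T₃ (π₄ : Fin 3 → OrderSet 4) (π₃ : Fin 4 → OrderSet 3) (π₂ : Fin 3 → OrderSet 2)
    (A B : Fin 3 → (H →L[ℂ] H)) (M : Fin 3 → Fin 3 → (H →L[ℂ] H)) (ψ : H) : ℝ :=
  permCorr (π₄ 0) ![A 0, A 1, B 2, M 0 1] ψ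
    + permCorr (π₄ 1) ![A 2, A 0, B 1, M 2 0] ψ
    + permCorr (π₄ 2) ![A 1, A 2, B 0, M 1 2] ψ
    + permCorr (π₃ 0) ![A 0, B 1, B 2] ψ
    + permCorr (π₃ 1) ![B 0, A 1, B 2] ψ
    + permCorr (π₃ 2) ![B 0, B 1, A 2] ψ
    - permCorr (π₃ 3) ![A 0, A 1, A 2] ψ
    + permCorr (π₂ 0) ![M 1 2, M 2 0] ψ
    + permCorr (π₂ 1) ![M 2 0, M 0 1] ψ
    + permCorr (π₂ 2) ![M 1 2, M 0 1] ψ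

/-- The subspace spanned by `ψ`, the `A i ψ`, the `B i ψ` and `A 0 (B 0 ψ)`. -/
def V₃ (A B : Fin 3 → (H →L[ℂ] H)) (ψ : H) : Submodule ℂ H :=
  Submodule.span ℂ (Set.range
    ![ψ, A 0 ψ, A 1 ψ, A 2 ψ, B 0 ψ, B 1 ψ, B 2 ψ, A 0 (B 0 ψ)])

instance finiteDimensional_V₃ (A B : Fin 3 → (H →L[ℂ] H)) (ψ : H) : FiniteDimensional ℂ (V₃ A B ψ) :=
  FiniteDimensional.span_of_finite ℂ (Set.finite_range _)

/-- `P M P†`, where `P : H → V` is the orthogonal projection onto `V`; its adjoint `P†` is the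
inclusion of `V` into `H`. -/
def compress (V : Submodule ℂ H) [V.HasOrthogonalProjection] (M : H →L[ℂ] H) : V →L[ℂ] V :=
  V.orthogonalProjectionOnto ∘L M ∘L V.subtypeL

end Sequential

/-- The Hilbert space `ℂ²` of a qubit. -/
abbrev Qubit : Type := EuclideanSpace ℂ (Fin 2)

/-- The Hilbert space `(ℂ²)^{⊗3}` of three qubits in the computational basis: the basis vectors
`|x 0, x 1, x 2⟩` are indexed by the maps `x : Fin 3 → Fin 2`. -/
abbrev ThreeQubits : Type := EuclideanSpace ℂ (Fin 3 → Fin 2)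

/-- The product vector `v 0 ⊗ v 1 ⊗ v 2`. -/
def productVec (v : Fin 3 → Qubit) : ThreeQubits :=
  WithLp.toLp 2 fun x => ∏ l, v l (x l)

/-- The Pauli matrix `X`. -/
def pauliX : Matrix (Fin 2) (Fin 2) ℂ := !![0, 1; 1, 0]

/-- The Pauli matrix `Z`. -/
def pauliZ : Matrix (Fin 2) (Fin 2) ℂ := !![1, 0; 0, -1]

/-- The operator `σ 0 ⊗ σ 1 ⊗ σ 2` on three qubits (Kronecker product of matrices). -/
def tensorOp (σ : Fin 3 → Matrix (Fin 2) (Fin 2) ℂ) : ThreeQubits →L[ℂ] ThreeQubits :=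
  Matrix.toEuclideanCLM (𝕜 := ℂ) (Matrix.of fun x y => ∏ l, σ l (x l) (y l))

/-- The operator `σ 0 ⊗ σ 1 ⊗ σ 2` acts factor by factor on product vectors. -/
theorem tensorOp_productVec (σ : Fin 3 → Matrix (Fin 2) (Fin 2) ℂ) (v : Fin 3 → Qubit) :
    tensorOp σ (productVec v)
      = productVec fun l => Matrix.toEuclideanCLM (𝕜 := ℂ) (σ l) (v l) := by
  ext x
  simp only [tensorOp, productVec, Matrix.ofLp_toEuclideanCLM, Matrix.mulVec, dotProduct,
    Matrix.of_apply, ← Finset.prod_mul_distrib, Finset.prod_univ_sum, Fintype.piFinset_univ]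

/-- The inner product of product vectors is the product of the inner products. -/
theorem inner_productVec (v w : Fin 3 → Qubit) :
    inner ℂ (productVec v) (productVec w) = ∏ l, inner ℂ (v l) (w l) := by
  simp only [productVec, PiLp.inner_apply, RCLike.inner_apply, map_prod,
    ← Finset.prod_mul_distrib, Finset.prod_univ_sum, Fintype.piFinset_univ]

/-- `X` on the `i`-th qubit. -/
def X (i : Fin 3) : ThreeQubits →L[ℂ] ThreeQubits :=
  tensorOp fun l => if l = i then pauliX else 1

/-- `Z` on the `i`-th qubit. -/
def Z (i : Fin 3) : ThreeQubits →L[ℂ] ThreeQubits :=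
  tensorOp fun l => if l = i then pauliZ else 1

/-- For `i ≠ j`: `X` on the qubits `i` and `j` and `Z` on the remaining qubit. -/
def XXZ (i j : Fin 3) : ThreeQubits →L[ℂ] ThreeQubits :=
  tensorOp fun l => if l = i ∨ l = j then pauliX else pauliZ

/-- The computational basis vector `|a b c⟩`. -/
def ket (a b c : Fin 2) : ThreeQubits := EuclideanSpace.single ![a, b, c] 1

/-- The graph state of the complete graph on three vertices. -/
def G₃ : ThreeQubits :=
  ((1 / Real.sqrt 8 : ℝ) : ℂ) •
    (ket 0 0 0 + ket 1 0 0 + ket 0 1 0 - ket 1 1 0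
      + ket 0 0 1 - ket 1 0 1 - ket 0 1 1 - ket 1 1 1)

end

end TemporalSelfTest

/-!
Each correlator of `T₃` is at most `1` in absolute value, so the value `10` forces all of them to
their extremal values. A projective measurement does not change the squared norm on average, hence
an extremal sequential correlation forces each word of the nested anticommutator, and therefore each
ordering of the product, to act on `ψ` as `±1`. The resulting relations show that `A i`, `B i` and
`M i j` permute, up to signs, the eight vectors `B^x ψ` indexed by bit strings `x`, exactly as
`X i`, `Z i` and `X i * X j * Z k` permute the vectors `Z^x G₃`. Both families are orthonormal:
applying the `B i` shows that `⟪B^x ψ, B^y ψ⟫` depends on `x + y` only, while applying `A i`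
multiplies it by `(-1) ^ (x i + y i)`. The unitary is the change of basis between the two families.
-/

namespace TemporalSelfTest

section Dichotomic

theorem sum_intUnits {α : Type*} [AddCommMonoid α] (f : ℤˣ → α) : ∑ c, f c = f 1 + f (-1) := by
  rw [UnitsInt.univ, Finset.sum_pair (by decide)]

variable {H : Type*} [NormedAddCommGroup H] [InnerProductSpace ℂ H]

theorem outcomeProj_apply (C : H →L[ℂ] H) (c : ℤˣ) (x : H) :
    outcomeProj C c x = (1 / 2 : ℂ) • (x + c • C x) :=
  rfl

theorem sum_outcomeProj_apply (C : H →L[ℂ] H) (x : H) : ∑ c : ℤˣ, outcomeProj C c x = x := by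
  simp only [sum_intUnits, outcomeProj_apply, one_smul, Units.neg_smul]
  module

theorem sum_smul_outcomeProj_apply (C : H →L[ℂ] H) (x : H) :
    ∑ c : ℤˣ, c • outcomeProj C c x = C x := by
  simp only [sum_intUnits, outcomeProj_apply, one_smul, Units.neg_smul]
  module

variable [CompleteSpace H] {C : H →L[ℂ] H}

namespace IsDichotomic

theorem apply_apply (hC : IsDichotomic C) (x : H) : C (C x) = x := by
  simpa using DFunLike.congr_fun hC.2 x

theorem apply_eq_iff (hC : IsDichotomic C) {x y : H} : C x = y ↔ x = C y :=
  ⟨fun h => by rw [← h, hC.apply_apply], fun h => by rw [h, hC.apply_apply]⟩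

theorem inner_apply_apply (hC : IsDichotomic C) (x y : H) :
    inner ℂ (C x) (C y) = inner ℂ x y := by
  have hsymm : inner ℂ (C x) (C y) = inner ℂ x (C (C y)) := hC.1.isSymmetric x (C y)
  rw [hsymm, hC.apply_apply]

theorem norm_apply (hC : IsDichotomic C) (x : H) : ‖C x‖ = ‖x‖ := by
  rw [norm_eq_sqrt_re_inner (𝕜 := ℂ), hC.inner_apply_apply, ← norm_eq_sqrt_re_inner]

theorem apply_outcomeProj (hC : IsDichotomic C) (c : ℤˣ) (x : H) :
    C (outcomeProj C c x) = c • outcomeProj C c x := by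
  rcases Int.units_eq_one_or c with rfl | rfl <;>
    simp [outcomeProj_apply, hC.apply_apply, add_comm]

theorem sum_norm_sq_outcomeProj (hC : IsDichotomic C) (x : H) :
    ∑ c : ℤˣ, ‖outcomeProj C c x‖ ^ 2 = ‖x‖ ^ 2 := by
  have parallelogram := parallelogram_law_with_norm ℂ x (C x)
  rw [hC.norm_apply] at parallelogram
  simp only [sum_intUnits, outcomeProj_apply, one_smul, Units.neg_smul, ← sub_eq_add_neg,
    norm_smul, mul_pow]
  norm_num
  linarith

end IsDichotomic

end Dichotomic

section Saturation

variable {H : Type*} [NormedAddCommGroup H] [InnerProductSpace ℂ H]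

theorem seqCorr_zero (M : Fin 0 → (H →L[ℂ] H)) (ψ : H) : seqCorr M ψ = ‖ψ‖ ^ 2 := by
  simp [seqCorr, outcomeProb, postState]

theorem seqCorr_succ {n : ℕ} (M : Fin (n + 1) → (H →L[ℂ] H)) (ψ : H) :
    seqCorr M ψ = ∑ c : ℤˣ, ((c : ℤ) : ℝ) *
      seqCorr (fun i => M i.succ) (outcomeProj (M 0) c ψ) := by
  simp only [seqCorr, outcomeProb, Finset.mul_sum]
  rw [← Fintype.sum_prod_type', ← (Fin.consEquiv fun _ => ℤˣ).sum_comp]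
  refine Finset.sum_congr rfl fun x _ => ?_
  simp [Fin.prod_univ_succ, postState, Fin.consEquiv, List.ofFn_succ, mul_assoc]

theorem mul_seqCorr_succ {n : ℕ} (s : ℤˣ) (M : Fin (n + 1) → (H →L[ℂ] H)) (ψ : H) :
    ((s : ℤ) : ℝ) * seqCorr M ψ = ∑ c : ℤˣ, (((s * c : ℤˣ) : ℤ) : ℝ) *
      seqCorr (fun i => M i.succ) (outcomeProj (M 0) c ψ) := by
  simp only [seqCorr_succ, Finset.mul_sum, Units.val_mul, Int.cast_mul, mul_assoc]

theorem seqWords_map {α β : Type*} (f : α → β) (l : List α) :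
    seqWords (l.map f) = (seqWords l).map (List.map f) := by
  induction l with
  | nil => rfl
  | cons a l ih => simp [seqWords, ih, Function.comp_def]

variable [CompleteSpace H]

theorem mul_seqCorr_le {n : ℕ} {M : Fin n → (H →L[ℂ] H)} (hM : ∀ i, IsDichotomic (M i)) (s : ℤˣ)
    (ψ : H) : ((s : ℤ) : ℝ) * seqCorr M ψ ≤ ‖ψ‖ ^ 2 := by
  induction n generalizing s ψ with
  | zero =>
    rcases Int.units_eq_one_or s with rfl | rfl <;> simp [seqCorr_zero]
  | succ n ih =>
    rw [mul_seqCorr_succ, ← (hM 0).sum_norm_sq_outcomeProj]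
    exact Finset.sum_le_sum fun c _ => ih (fun i => hM i.succ) _ _

theorem mul_seqCorr_outcomeProj_eq {n : ℕ} {M : Fin (n + 1) → (H →L[ℂ] H)}
    (hM : ∀ i, IsDichotomic (M i)) {s : ℤˣ} {ψ : H}
    (h : ((s : ℤ) : ℝ) * seqCorr M ψ = ‖ψ‖ ^ 2) (c : ℤˣ) :
    (((s * c : ℤˣ) : ℤ) : ℝ) * seqCorr (fun i => M i.succ) (outcomeProj (M 0) c ψ)
      = ‖outcomeProj (M 0) c ψ‖ ^ 2 := by
  rw [mul_seqCorr_succ, ← (hM 0).sum_norm_sq_outcomeProj] at h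
  exact (Finset.sum_eq_sum_iff_of_le fun c _ => mul_seqCorr_le (fun i => hM i.succ) _ _).1 h c
    (Finset.mem_univ c)

-- Conditioned on the first outcome `c`, the remaining measurements are again perfectly correlated,
-- with sign `s * c`; so their words act on the `c`-eigencomponent of `ψ` as `s * c`.
theorem prod_apply_of_mul_seqCorr_eq {n : ℕ} {M : Fin n → (H →L[ℂ] H)}
    (hM : ∀ i, IsDichotomic (M i)) {s : ℤˣ} {ψ : H}
    (h : ((s : ℤ) : ℝ) * seqCorr M ψ = ‖ψ‖ ^ 2) {w : List (H →L[ℂ] H)}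
    (hw : w ∈ seqWords (List.ofFn M)) : w.prod ψ = s • ψ := by
  induction n generalizing s ψ w with
  | zero =>
    obtain rfl : w = [] := by simpa [seqWords] using hw
    rcases Int.units_eq_one_or s with rfl | rfl
    · simp
    · have : ψ = 0 := by simpa [seqCorr_zero, neg_eq_self] using h
      simp [this]
  | succ n ih =>
    have tail_apply {u : List (H →L[ℂ] H)} (hu : u ∈ seqWords (List.ofFn fun i => M i.succ))
        (c : ℤˣ) : u.prod (outcomeProj (M 0) c ψ) = (s * c) • outcomeProj (M 0) c ψ :=
      ih (fun i => hM i.succ) (mul_seqCorr_outcomeProj_eq hM h c) hu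
    simp only [List.ofFn_succ, seqWords, List.mem_append, List.mem_map] at hw
    rcases hw with ⟨u, hu, rfl⟩ | ⟨u, hu, rfl⟩
    · calc (M 0 :: u).prod ψ = M 0 (u.prod (∑ c : ℤˣ, outcomeProj (M 0) c ψ)) := by
            rw [sum_outcomeProj_apply, List.prod_cons]; rfl
        _ = ∑ c : ℤˣ, s • outcomeProj (M 0) c ψ := by
            simp only [map_sum, tail_apply hu, Units.smul_def, map_zsmul,
              (hM 0).apply_outcomeProj, smul_smul, ← Units.val_mul, mul_assoc, Int.units_mul_self,
              mul_one]
        _ = s • ψ := by rw [← Finset.smul_sum, sum_outcomeProj_apply]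
    · calc (u ++ [M 0]).prod ψ = u.prod (∑ c : ℤˣ, c • outcomeProj (M 0) c ψ) := by
            rw [sum_smul_outcomeProj_apply, List.prod_append, List.prod_singleton]; rfl
        _ = ∑ c : ℤˣ, s • outcomeProj (M 0) c ψ := by
            simp only [map_sum, tail_apply hu, Units.smul_def, map_zsmul, smul_smul,
              ← Units.val_mul, mul_left_comm _ s, Int.units_mul_self, mul_one]
        _ = s • ψ := by rw [← Finset.smul_sum, sum_outcomeProj_apply]

variable {n : ℕ} {M : Fin n → (H →L[ℂ] H)}

theorem OrderSet.card_pos (S : OrderSet n) : (0 : ℝ) < S.1.card := by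
  obtain ⟨σ, hσ, -⟩ := S.2 1
  exact_mod_cast Finset.card_pos.2 ⟨σ, hσ⟩

theorem mul_permCorr_le (S : OrderSet n) (hM : ∀ i, IsDichotomic (M i)) (s : ℤˣ) (ψ : H) :
    ((s : ℤ) : ℝ) * permCorr S M ψ ≤ ‖ψ‖ ^ 2 := by
  rw [permCorr, mul_left_comm, inv_mul_le_iff₀ S.card_pos, Finset.mul_sum, ← nsmul_eq_mul]
  exact Finset.sum_le_card_nsmul _ _ _ fun σ _ => mul_seqCorr_le (fun i => hM (σ i)) s ψ

theorem mul_seqCorr_eq_of_mul_permCorr_eq {S : OrderSet n} (hM : ∀ i, IsDichotomic (M i))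
    {s : ℤˣ} {ψ : H} (h : ((s : ℤ) : ℝ) * permCorr S M ψ = ‖ψ‖ ^ 2)
    {σ : Equiv.Perm (Fin n)} (hσ : σ ∈ S.1) :
    ((s : ℤ) : ℝ) * seqCorr (fun i => M (σ i)) ψ = ‖ψ‖ ^ 2 := by
  rw [permCorr, mul_left_comm, inv_mul_eq_iff_eq_mul₀ S.card_pos.ne', Finset.mul_sum,
    ← nsmul_eq_mul, ← Finset.sum_const] at h
  have hle (σ : Equiv.Perm (Fin n)) (_ : σ ∈ S.1) := mul_seqCorr_le (fun i => hM (σ i)) s ψ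
  exact (Finset.sum_eq_sum_iff_of_le hle).1 h σ hσ

end Saturation

section AnyOrder

theorem exists_perm_of_perm_ofFn {α : Type*} {n : ℕ} {f : Fin n → α} {l : List α}
    (hl : l.Perm (List.ofFn f)) : ∃ τ : Equiv.Perm (Fin n), l = List.ofFn (f ∘ τ) := by
  obtain ⟨k, hk, rfl⟩ : ∃ k : List (Fin n), k.Perm (List.finRange n) ∧ k.map f = l := by
    simpa only [List.ofFn_eq_map, ← List.mem_permutations, ← List.map_permutations,
      List.mem_map] using hl
  have hlength : n = k.length := by simpa using hk.length_eq.symm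
  have hnodup : k.Nodup := hk.nodup_iff.2 (List.nodup_finRange n)
  have hmem (i : Fin n) : i ∈ k := hk.mem_iff.2 (List.mem_finRange i)
  exact ⟨(finCongr hlength).trans (hnodup.getEquivOfForallMemList k hmem),
    List.ext_getElem (by simp [hlength]) (by simp)⟩

variable {H : Type*} [NormedAddCommGroup H] [InnerProductSpace ℂ H]

/-- The product of the operators in `l`, taken in any order, maps `ψ` to `s • ψ`. -/
def EigenInAnyOrder (l : List (H →L[ℂ] H)) (s : ℤˣ) (ψ : H) : Prop :=
  ∀ w : List (H →L[ℂ] H), w.Perm l → w.prod ψ = s • ψ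

namespace EigenInAnyOrder

variable {a b : H →L[ℂ] H} {l : List (H →L[ℂ] H)} {s : ℤˣ} {ψ : H}

theorem swap (h : EigenInAnyOrder (a :: b :: l) s ψ) : EigenInAnyOrder (b :: a :: l) s ψ :=
  fun w hw => h w (hw.trans (.swap a b l))

theorem rotate (h : EigenInAnyOrder (a :: l) s ψ) : EigenInAnyOrder (l ++ [a]) s ψ :=
  fun w hw => h w (hw.trans (List.perm_append_singleton a l))

theorem prod_apply (h : EigenInAnyOrder l s ψ) : l.prod ψ = s • ψ :=
  h l (.refl l)

end EigenInAnyOrder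

theorem eigenInAnyOrder_of_mul_permCorr_eq [CompleteSpace H] {n : ℕ} {M : Fin n → (H →L[ℂ] H)}
    {S : OrderSet n} (hM : ∀ i, IsDichotomic (M i)) {s : ℤˣ} {ψ : H}
    (h : ((s : ℤ) : ℝ) * permCorr S M ψ = ‖ψ‖ ^ 2) : EigenInAnyOrder (List.ofFn M) s ψ := by
  intro w hw
  obtain ⟨τ, rfl⟩ := exists_perm_of_perm_ofFn hw
  obtain ⟨σ, hσ, hτ⟩ := S.2 τ
  have hword := List.mem_map_of_mem (f := List.map M) hτ
  rw [← seqWords_map, List.map_ofFn, List.map_ofFn] at hword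
  exact prod_apply_of_mul_seqCorr_eq (fun i => hM (σ i))
    (mul_seqCorr_eq_of_mul_permCorr_eq hM h hσ) hword

end AnyOrder

section Relations

/-- The indices `i`, `j`, `k` are `0`, `1`, `2` in some order. -/
abbrev Distinct (i j k : Fin 3) : Prop := i ≠ j ∧ j ≠ k ∧ k ≠ i

theorem forall_distinct {p : Fin 3 → Fin 3 → Fin 3 → Prop} (h₀ : p 0 1 2) (h₁ : p 1 2 0)
    (h₂ : p 2 0 1) (swap : ∀ i j k, p i j k → p j i k) {i j k : Fin 3} (h : Distinct i j k) :
    p i j k := by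
  have cyclic : (i, j, k) ∈ [((0, 1, 2) : Fin 3 × Fin 3 × Fin 3), (1, 2, 0), (2, 0, 1)]
      ∨ (j, i, k) ∈ [((0, 1, 2) : Fin 3 × Fin 3 × Fin 3), (1, 2, 0), (2, 0, 1)] := by
    revert i j k; decide
  simp only [List.mem_cons, Prod.mk.injEq, List.not_mem_nil, or_false] at cyclic
  rcases cyclic with hc | hc
  · rcases hc with ⟨rfl, rfl, rfl⟩ | ⟨rfl, rfl, rfl⟩ | ⟨rfl, rfl, rfl⟩ <;> assumption
  · rcases hc with ⟨rfl, rfl, rfl⟩ | ⟨rfl, rfl, rfl⟩ | ⟨rfl, rfl, rfl⟩ <;> exact swap _ _ _ ‹_›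

theorem Distinct.rotate {i j k : Fin 3} (h : Distinct i j k) : Distinct j k i :=
  ⟨h.2.1, h.2.2, h.1⟩

theorem Distinct.swap {i j k : Fin 3} (h : Distinct i j k) : Distinct j i k :=
  ⟨h.1.symm, h.2.2.symm, h.2.1.symm⟩

theorem exists_distinct {i j : Fin 3} (hij : i ≠ j) : ∃ k, Distinct i j k := by
  revert i j; decide

theorem exists_distinct_left (i : Fin 3) : ∃ j k, Distinct i j k := by
  revert i; decide

variable {H : Type*} [NormedAddCommGroup H] [InnerProductSpace ℂ H] [CompleteSpace H]

/-- The observables `A`, `B`, `M` are perfectly correlated on `ψ`, in every order, in each of the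
ten correlators of `T₃`. The two-point correlators `⟨M M'⟩` enter in the equivalent form
`M ψ = M' ψ`. -/
structure PerfectlyCorrelated (A B : Fin 3 → (H →L[ℂ] H)) (M : Fin 3 → Fin 3 → (H →L[ℂ] H))
    (ψ : H) : Prop where
  dichotomic_A (i : Fin 3) : IsDichotomic (A i)
  dichotomic_B (i : Fin 3) : IsDichotomic (B i)
  dichotomic_M {i j : Fin 3} : i ≠ j → IsDichotomic (M i j)
  AABM {i j k : Fin 3} : Distinct i j k → EigenInAnyOrder [A i, A j, B k, M i j] 1 ψ
  BBA {i j k : Fin 3} : Distinct i j k → EigenInAnyOrder [B i, B j, A k] 1 ψ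
  AAA {i j k : Fin 3} : Distinct i j k → EigenInAnyOrder [A i, A j, A k] (-1) ψ
  M_apply {i j : Fin 3} : i ≠ j → M i j ψ = M 0 1 ψ

variable {A B : Fin 3 → (H →L[ℂ] H)} {M : Fin 3 → Fin 3 → (H →L[ℂ] H)} {ψ : H}

theorem permCorr_le_one {n : ℕ} {C : Fin n → (H →L[ℂ] H)} (S : OrderSet n) (hψ : ‖ψ‖ = 1)
    (hC : ∀ l, IsDichotomic (C l)) : permCorr S C ψ ≤ 1 := by
  simpa [hψ] using mul_permCorr_le S hC 1 ψ

theorem neg_one_le_permCorr {n : ℕ} {C : Fin n → (H →L[ℂ] H)} (S : OrderSet n) (hψ : ‖ψ‖ = 1)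
    (hC : ∀ l, IsDichotomic (C l)) : -1 ≤ permCorr S C ψ := by
  simpa [hψ, neg_le] using mul_permCorr_le S hC (-1) ψ

theorem eigenInAnyOrder_of_one_le_permCorr {n : ℕ} {C : Fin n → (H →L[ℂ] H)} {S : OrderSet n}
    (hψ : ‖ψ‖ = 1) (hC : ∀ i, IsDichotomic (C i)) (h : 1 ≤ permCorr S C ψ) :
    EigenInAnyOrder (List.ofFn C) 1 ψ :=
  eigenInAnyOrder_of_mul_permCorr_eq hC <|
    (mul_permCorr_le S hC 1 ψ).antisymm (by simpa [hψ] using h)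

theorem eigenInAnyOrder_of_permCorr_le_neg_one {n : ℕ} {C : Fin n → (H →L[ℂ] H)} {S : OrderSet n}
    (hψ : ‖ψ‖ = 1) (hC : ∀ i, IsDichotomic (C i)) (h : permCorr S C ψ ≤ -1) :
    EigenInAnyOrder (List.ofFn C) (-1) ψ :=
  eigenInAnyOrder_of_mul_permCorr_eq hC <|
    (mul_permCorr_le S hC (-1) ψ).antisymm (by simpa [hψ] using le_neg.1 h)

theorem eigenInAnyOrder_of_T₃_eq (hψ : ‖ψ‖ = 1) {π₄ : Fin 3 → OrderSet 4} {π₃ : Fin 4 → OrderSet 3}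
    {π₂ : Fin 3 → OrderSet 2} (hA : ∀ i, IsDichotomic (A i)) (hB : ∀ i, IsDichotomic (B i))
    (hM : ∀ i j, i ≠ j → IsDichotomic (M i j)) (hmax : T₃ π₄ π₃ π₂ A B M ψ = 10) :
    (EigenInAnyOrder [A 0, A 1, B 2, M 0 1] 1 ψ ∧ EigenInAnyOrder [A 2, A 0, B 1, M 2 0] 1 ψ ∧
      EigenInAnyOrder [A 1, A 2, B 0, M 1 2] 1 ψ) ∧
    (EigenInAnyOrder [A 0, B 1, B 2] 1 ψ ∧ EigenInAnyOrder [B 0, A 1, B 2] 1 ψ ∧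
      EigenInAnyOrder [B 0, B 1, A 2] 1 ψ ∧ EigenInAnyOrder [A 0, A 1, A 2] (-1) ψ) ∧
    EigenInAnyOrder [M 2 0, M 0 1] 1 ψ ∧ EigenInAnyOrder [M 1 2, M 0 1] 1 ψ := by
  have hM₀₁ : IsDichotomic (M 0 1) := hM 0 1 (by decide)
  have hM₁₂ : IsDichotomic (M 1 2) := hM 1 2 (by decide)
  have hM₂₀ : IsDichotomic (M 2 0) := hM 2 0 (by decide)
  have hAABM {i j : Fin 3} (hij : IsDichotomic (M i j)) (k : Fin 3) :
      ∀ l, IsDichotomic (![A i, A j, B k, M i j] l) := by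
    simp [Fin.forall_fin_succ, hA, hB, hij]
  have hABB : ∀ l, IsDichotomic (![A 0, B 1, B 2] l) := by simp [Fin.forall_fin_succ, hA, hB]
  have hBAB : ∀ l, IsDichotomic (![B 0, A 1, B 2] l) := by simp [Fin.forall_fin_succ, hA, hB]
  have hBBA : ∀ l, IsDichotomic (![B 0, B 1, A 2] l) := by simp [Fin.forall_fin_succ, hA, hB]
  have hAAA : ∀ l, IsDichotomic (![A 0, A 1, A 2] l) := by simp [Fin.forall_fin_succ, hA]
  have hMM {C D : H →L[ℂ] H} (hC : IsDichotomic C) (hD : IsDichotomic D) :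
      ∀ l, IsDichotomic (![C, D] l) := by
    simp [Fin.forall_fin_succ, hC, hD]
  rw [T₃] at hmax
  have := permCorr_le_one (π₄ 0) hψ (hAABM hM₀₁ 2)
  have := permCorr_le_one (π₄ 1) hψ (hAABM hM₂₀ 1)
  have := permCorr_le_one (π₄ 2) hψ (hAABM hM₁₂ 0)
  have := permCorr_le_one (π₃ 0) hψ hABB
  have := permCorr_le_one (π₃ 1) hψ hBAB
  have := permCorr_le_one (π₃ 2) hψ hBBA
  have := neg_one_le_permCorr (π₃ 3) hψ hAAA
  have := permCorr_le_one (π₂ 0) hψ (hMM hM₁₂ hM₂₀)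
  have := permCorr_le_one (π₂ 1) hψ (hMM hM₂₀ hM₀₁)
  have := permCorr_le_one (π₂ 2) hψ (hMM hM₁₂ hM₀₁)
  refine ⟨⟨?_, ?_, ?_⟩, ⟨?_, ?_, ?_, ?_⟩, ?_, ?_⟩
  · exact eigenInAnyOrder_of_one_le_permCorr (S := π₄ 0) hψ (hAABM hM₀₁ 2) (by linarith)
  · exact eigenInAnyOrder_of_one_le_permCorr (S := π₄ 1) hψ (hAABM hM₂₀ 1) (by linarith)
  · exact eigenInAnyOrder_of_one_le_permCorr (S := π₄ 2) hψ (hAABM hM₁₂ 0) (by linarith)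
  · exact eigenInAnyOrder_of_one_le_permCorr (S := π₃ 0) hψ hABB (by linarith)
  · exact eigenInAnyOrder_of_one_le_permCorr (S := π₃ 1) hψ hBAB (by linarith)
  · exact eigenInAnyOrder_of_one_le_permCorr (S := π₃ 2) hψ hBBA (by linarith)
  · exact eigenInAnyOrder_of_permCorr_le_neg_one (C := ![A 0, A 1, A 2]) hψ hAAA
      (S := π₃ 3) (by linarith)
  · exact eigenInAnyOrder_of_one_le_permCorr (S := π₂ 1) hψ (hMM hM₂₀ hM₀₁) (by linarith)
  · exact eigenInAnyOrder_of_one_le_permCorr (S := π₂ 2) hψ (hMM hM₁₂ hM₀₁) (by linarith)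

theorem perfectlyCorrelated_of_T₃_eq (hψ : ‖ψ‖ = 1) {π₄ : Fin 3 → OrderSet 4}
    {π₃ : Fin 4 → OrderSet 3} {π₂ : Fin 3 → OrderSet 2} (hA : ∀ i, IsDichotomic (A i))
    (hB : ∀ i, IsDichotomic (B i)) (hM : ∀ i j, i ≠ j → IsDichotomic (M i j))
    (hMsymm : ∀ i j, M i j = M j i) (hmax : T₃ π₄ π₃ π₂ A B M ψ = 10) :
    PerfectlyCorrelated A B M ψ := by
  obtain ⟨⟨AABM₀₁, AABM₂₀, AABM₁₂⟩, ⟨ABB, BAB, BBA, AAA⟩, MM₂₀, MM₁₂⟩ :=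
    eigenInAnyOrder_of_T₃_eq hψ hA hB hM hmax
  exact
  { dichotomic_A := hA
    dichotomic_B := hB
    dichotomic_M := hM _ _
    AABM := forall_distinct (p := fun i j k => EigenInAnyOrder [A i, A j, B k, M i j] 1 ψ)
      AABM₀₁ AABM₁₂ AABM₂₀ fun i j _ h => hMsymm i j ▸ h.swap
    BBA := forall_distinct (p := fun i j k => EigenInAnyOrder [B i, B j, A k] 1 ψ)
      BBA ABB.rotate BAB.rotate.rotate fun _ _ _ h => h.swap
    AAA := forall_distinct (p := fun i j k => EigenInAnyOrder [A i, A j, A k] (-1) ψ)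
      AAA AAA.rotate AAA.rotate.rotate fun _ _ _ h => h.swap
    M_apply := fun {i j} hij => by
      obtain ⟨k, hk⟩ := exists_distinct hij
      refine forall_distinct (p := fun i j _ => M i j ψ = M 0 1 ψ) rfl ?_ ?_
        (fun i j _ h => hMsymm i j ▸ h) hk
      · simpa using ((hM 1 2 (by decide)).apply_eq_iff.1 MM₁₂.prod_apply).symm
      · simpa using ((hM 2 0 (by decide)).apply_eq_iff.1 MM₂₀.prod_apply).symm }

namespace PerfectlyCorrelated

variable {i j k : Fin 3}

theorem A_A_apply (h : PerfectlyCorrelated A B M ψ) (hd : Distinct i j k) :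
    A i (A j ψ) = -A k ψ := by
  have AAA : A k (A i (A j ψ)) = -ψ := by simpa using (h.AAA hd.rotate.rotate).prod_apply
  simpa using (h.dichotomic_A k).apply_eq_iff.1 AAA

theorem A_B_apply (h : PerfectlyCorrelated A B M ψ) (hd : Distinct i j k) :
    A i (B j ψ) = B k ψ := by
  have BAB : B k (A i (B j ψ)) = ψ := by simpa using (h.BBA hd.rotate).rotate.prod_apply
  exact (h.dichotomic_B k).apply_eq_iff.1 BAB

theorem B_A_apply (h : PerfectlyCorrelated A B M ψ) (hd : Distinct i j k) :
    B i (A j ψ) = B k ψ := by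
  have BBA : B k (B i (A j ψ)) = ψ := by simpa using (h.BBA hd.rotate.rotate).prod_apply
  exact (h.dichotomic_B k).apply_eq_iff.1 BBA

theorem B_B_apply (h : PerfectlyCorrelated A B M ψ) (hd : Distinct i j k) :
    B i (B j ψ) = A k ψ := by
  have ABB : A k (B i (B j ψ)) = ψ := by simpa using (h.BBA hd).rotate.rotate.prod_apply
  exact (h.dichotomic_A k).apply_eq_iff.1 ABB

theorem A_B_self_apply (h : PerfectlyCorrelated A B M ψ) (i : Fin 3) :
    A i (B i ψ) = M 0 1 ψ := by
  obtain ⟨j, k, hd⟩ := exists_distinct_left i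
  have MAAB : M i j (A i (A j (B k ψ))) = ψ := by
    simpa using (h.AABM hd).rotate.rotate.rotate.prod_apply
  rw [← h.M_apply hd.1, ← h.A_B_apply hd.rotate]
  exact (h.dichotomic_M hd.1).apply_eq_iff.1 MAAB

theorem B_A_self_apply (h : PerfectlyCorrelated A B M ψ) (i : Fin 3) :
    B i (A i ψ) = -M 0 1 ψ := by
  obtain ⟨j, k, hd⟩ := exists_distinct_left i
  have MBAA : M j k (B i (A j (A k ψ))) = ψ := by
    simpa using (h.AABM hd.rotate).rotate.rotate.swap.prod_apply
  rw [h.A_A_apply hd.rotate, (h.dichotomic_M hd.2.1).apply_eq_iff, h.M_apply hd.2.1] at MBAA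
  rw [← MBAA, map_neg, neg_neg]

theorem M_A_left_apply (h : PerfectlyCorrelated A B M ψ) (hij : i ≠ j) :
    M i j (A i ψ) = B i ψ := by
  obtain ⟨k, hd⟩ := exists_distinct hij
  have ABMA : A j (B k (M i j (A i ψ))) = ψ := by simpa using (h.AABM hd).rotate.prod_apply
  rw [(h.dichotomic_A j).apply_eq_iff, (h.dichotomic_B k).apply_eq_iff] at ABMA
  rw [ABMA, h.B_A_apply hd.rotate.swap]

theorem M_A_right_apply (h : PerfectlyCorrelated A B M ψ) (hij : i ≠ j) :
    M i j (A j ψ) = B j ψ := by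
  obtain ⟨k, hd⟩ := exists_distinct hij
  have ABMA : A i (B k (M i j (A j ψ))) = ψ := by simpa using (h.AABM hd).swap.rotate.prod_apply
  rw [(h.dichotomic_A i).apply_eq_iff, (h.dichotomic_B k).apply_eq_iff] at ABMA
  rw [ABMA, h.B_A_apply hd.rotate.rotate]

theorem M_A_third_apply (h : PerfectlyCorrelated A B M ψ) (hd : Distinct i j k) :
    M i j (A k ψ) = -B k ψ := by
  have AAMB : A i (A j (M i j (B k ψ))) = ψ := by
    simpa using (h.AABM hd).rotate.rotate.swap.rotate.rotate.prod_apply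
  rw [(h.dichotomic_A i).apply_eq_iff, (h.dichotomic_A j).apply_eq_iff, h.A_A_apply hd.swap,
    (h.dichotomic_M hd.1).apply_eq_iff, map_neg] at AAMB
  rw [AAMB, neg_neg]

end PerfectlyCorrelated

end Relations

section SignedShift

variable {H ι : Type*} [NormedAddCommGroup H] [InnerProductSpace ℂ H] [Add ι]

/-- The operator `T` permutes the vectors `v x` up to signs, by translating the index by `t`. -/
def SignedShift (T : H →L[ℂ] H) (v : ι → H) (ε : ι → ℤˣ) (t : ι) : Prop :=
  ∀ x, T (v x) = ε x • v (x + t)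

namespace SignedShift

variable {T : H →L[ℂ] H} {v : ι → H} {ε : ι → ℤˣ} {t : ι}

theorem apply_mem_span (h : SignedShift T v ε t) {u : H}
    (hu : u ∈ Submodule.span ℂ (Set.range v)) : T u ∈ Submodule.span ℂ (Set.range v) := by
  have hle : Submodule.span ℂ (Set.range v) ≤
      (Submodule.span ℂ (Set.range v)).comap (T : H →ₗ[ℂ] H) := by
    rw [Submodule.span_le]
    rintro _ ⟨x, rfl⟩
    have hmem : v (x + t) ∈ Submodule.span ℂ (Set.range v) := Submodule.subset_span ⟨x + t, rfl⟩
    simpa [h x, Units.smul_def] using zsmul_mem hmem (ε x : ℤ)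
  exact hle hu

theorem inner_add [CompleteSpace H] (hT : IsDichotomic T) (h : SignedShift T v ε t) (x y : ι) :
    inner ℂ (v (x + t)) (v (y + t)) = (ε x * ε y) • inner ℂ (v x) (v y) := by
  rw [← hT.inner_apply_apply (v x) (v y), h x, h y]
  rcases Int.units_eq_one_or (ε x) with hx | hx <;>
    rcases Int.units_eq_one_or (ε y) with hy | hy <;> simp [hx, hy]

theorem mul {ι : Type*} [AddSemigroup ι] {S T : H →L[ℂ] H} {v : ι → H} {δ ε : ι → ℤˣ} {s t : ι}
    (hT : SignedShift T v ε t) (hS : SignedShift S v δ s) :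
    SignedShift (T * S) v (fun x => δ x * ε (x + s)) (s + t) := by
  intro x
  rw [mul_apply_eq_comp, hS x, Units.smul_def, map_zsmul, hT, ← Units.smul_def,
    smul_smul, add_assoc]

theorem equiv_compress_apply [Fintype ι] {F : Type*} [NormedAddCommGroup F]
    [InnerProductSpace ℂ F] {V : Submodule ℂ H} [V.HasOrthogonalProjection]
    (b : OrthonormalBasis ι ℂ V) (b' : OrthonormalBasis ι ℂ F) {T' : F →L[ℂ] F}
    (hT : SignedShift T (fun x => (b x : H)) ε t) (hT' : SignedShift T' b' ε t) (φ : F) :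
    b.equiv b' (.refl ι) (compress V T ((b.equiv b' (.refl ι)).symm φ)) = T' φ := by
  set U := b.equiv b' (.refl ι)
  have hU (x : ι) : U (b x) = b' x := by simp [U]
  have compress_basis (x : ι) : compress V T (b x) = ε x • b (x + t) := by
    have hproj := V.orthogonalProjectionOnto_mem_subspace_eq_self (ε x • b (x + t))
    rwa [show ((ε x • b (x + t) : V) : H) = T (b x) by simp [hT x, Units.smul_def]] at hproj
  have hext : U.toLinearMap ∘ₗ (compress V T).toLinearMap = T'.toLinearMap ∘ₗ U.toLinearMap :=
    b.toBasis.ext fun x => by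
      simp [compress_basis, hU, hT' x, Units.smul_def]
  simpa using DFunLike.congr_fun hext (U.symm φ)

end SignedShift

end SignedShift

section GraphBasis

/-- The sign `(-1) ^ a` of a bit `a`. -/
def bitSign (a : Fin 2) : ℤˣ := if a = 0 then 1 else -1

/-- The bit string whose only non-zero entry is at position `i`. Bit strings are added modulo
`2`. -/
abbrev bit (i : Fin 3) : Fin 3 → Fin 2 := Pi.single i 1

theorem eq_bit_or_eq_one_add_bit (x : Fin 3 → Fin 2) :
    x = 0 ∨ x = 1 ∨ (∃ l, x = bit l) ∨ ∃ l, x = 1 + bit l := by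
  revert x; decide

theorem bit_add_bit {i j k : Fin 3} (hd : Distinct i j k) : bit i + bit j = 1 + bit k := by
  revert i j k; decide

variable {H : Type*} [NormedAddCommGroup H] [InnerProductSpace ℂ H]

/-- The operators `A i`, `B i` and `M i j` act on the vectors `v x` in the way in which `X i`, `Z i`
and `X i * X j * Z k` act on the basis of three qubits obtained from the complete-graph state by
applying `Z`'s to the qubits `l` with `x l = 1`. -/
structure GraphAction (A B : Fin 3 → (H →L[ℂ] H)) (M : Fin 3 → Fin 3 → (H →L[ℂ] H))
    (v : (Fin 3 → Fin 2) → H) : Prop where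
  A_shift (i : Fin 3) : SignedShift (A i) v (fun x => bitSign (x i)) (1 + bit i)
  B_shift (i : Fin 3) : SignedShift (B i) v 1 (bit i)
  M_shift {i j : Fin 3} :
    i ≠ j → SignedShift (M i j) v (fun x => -(bitSign (x i) * bitSign (x j))) 1

/-- The vectors obtained from `ψ` by applying `B l` for each `l` with `x l = 1`. -/
def graphVec (B : Fin 3 → (H →L[ℂ] H)) (ψ : H) (x : Fin 3 → Fin 2) : H :=
  (B 0 ^ (x 0 : ℕ)) ((B 1 ^ (x 1 : ℕ)) ((B 2 ^ (x 2 : ℕ)) ψ))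

theorem graphVec_zero (B : Fin 3 → (H →L[ℂ] H)) (ψ : H) : graphVec B ψ 0 = ψ := by simp [graphVec]

theorem graphVec_bit (B : Fin 3 → (H →L[ℂ] H)) (ψ : H) (i : Fin 3) :
    graphVec B ψ (bit i) = B i ψ := by
  fin_cases i <;> simp [graphVec, bit]

variable {A B : Fin 3 → (H →L[ℂ] H)} {M : Fin 3 → Fin 3 → (H →L[ℂ] H)}
  {v : (Fin 3 → Fin 2) → H} {ψ : H} [CompleteSpace H]

namespace GraphAction

theorem inner_add_add (h : GraphAction A B M v) (hB : ∀ i, IsDichotomic (B i))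
    (x y t : Fin 3 → Fin 2) : inner ℂ (v (x + t)) (v (y + t)) = inner ℂ (v x) (v y) := by
  induction t using Pi.single_induction generalizing x y with
  | zero => simp only [add_zero]
  | add s t hs ht => rw [← add_assoc, ← add_assoc, ht, hs]
  | single i a =>
    obtain rfl | rfl : a = 0 ∨ a = 1 := by omega
    · simp only [Pi.single_zero, add_zero]
    · simpa using (h.B_shift i).inner_add (hB i) x y

theorem inner_eq_zero (h : GraphAction A B M v) (hA : ∀ i, IsDichotomic (A i))
    (hB : ∀ i, IsDichotomic (B i)) {x y : Fin 3 → Fin 2} (hxy : x ≠ y) :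
    inner ℂ (v x) (v y) = 0 := by
  obtain ⟨i, hi⟩ := Function.ne_iff.1 hxy
  have sign_eq : bitSign (x i) * bitSign (y i) = -1 := by
    revert hi; generalize x i = a, y i = b; decide +revert
  have inner_eq_neg := (h.A_shift i).inner_add (hA i) x y
  rw [h.inner_add_add hB, sign_eq, Units.neg_smul, one_smul] at inner_eq_neg
  exact self_eq_neg.1 inner_eq_neg

theorem orthonormal (h : GraphAction A B M v) (hA : ∀ i, IsDichotomic (A i))
    (hB : ∀ i, IsDichotomic (B i)) (hv : ‖v 0‖ = 1) : Orthonormal ℂ v := by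
  refine ⟨fun x => ?_, fun x y hxy => h.inner_eq_zero hA hB hxy⟩
  have inner_self := h.inner_add_add hB 0 0 x
  rw [zero_add] at inner_self
  rw [norm_eq_sqrt_re_inner (𝕜 := ℂ), inner_self, ← norm_eq_sqrt_re_inner, hv]

end GraphAction

namespace PerfectlyCorrelated

theorem graphVec_one_add_bit (h : PerfectlyCorrelated A B M ψ) (i : Fin 3) :
    graphVec B ψ (1 + bit i) = A i ψ := by
  fin_cases i
  · simp [graphVec, bit, h.B_B_apply (i := 1) (j := 2) (k := 0) (by decide)]
  · simp [graphVec, bit, h.B_B_apply (i := 0) (j := 2) (k := 1) (by decide)]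
  · simp [graphVec, bit, h.B_B_apply (i := 0) (j := 1) (k := 2) (by decide)]

theorem graphVec_one (h : PerfectlyCorrelated A B M ψ) : graphVec B ψ 1 = -M 0 1 ψ := by
  simp [graphVec, h.B_B_apply (i := 1) (j := 2) (k := 0) (by decide), h.B_A_self_apply]

theorem signedShift_A (h : PerfectlyCorrelated A B M ψ) (i : Fin 3) :
    SignedShift (A i) (graphVec B ψ) (fun x => bitSign (x i)) (1 + bit i) := by
  intro x
  rcases eq_bit_or_eq_one_add_bit x with rfl | rfl | ⟨j, rfl⟩ | ⟨j, rfl⟩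
  · rw [graphVec_zero, zero_add, h.graphVec_one_add_bit]
    simp [bitSign]
  · rw [h.graphVec_one, show 1 + (1 + bit i) = bit i by decide +revert, graphVec_bit,
      ← h.A_B_self_apply i]
    simp [bitSign, (h.dichotomic_A i).apply_apply]
  · rcases eq_or_ne i j with rfl | hij
    · rw [graphVec_bit, h.A_B_self_apply, show bit i + (1 + bit i) = 1 by decide +revert,
        h.graphVec_one]
      simp [bitSign]
    · obtain ⟨k, hd⟩ := exists_distinct hij
      rw [graphVec_bit, h.A_B_apply hd,
        show bit j + (1 + bit i) = bit k by revert i j k; decide, graphVec_bit]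
      simp [bitSign, hij]
  · rcases eq_or_ne i j with rfl | hij
    · rw [h.graphVec_one_add_bit, show 1 + bit i + (1 + bit i) = 0 by decide +revert,
        graphVec_zero, (h.dichotomic_A i).apply_apply]
      simp [bitSign]
    · obtain ⟨k, hd⟩ := exists_distinct hij
      rw [h.graphVec_one_add_bit, h.A_A_apply hd,
        show 1 + bit j + (1 + bit i) = 1 + bit k by revert i j k; decide, h.graphVec_one_add_bit]
      simp [bitSign, hij]

theorem signedShift_B (h : PerfectlyCorrelated A B M ψ) (i : Fin 3) :
    SignedShift (B i) (graphVec B ψ) 1 (bit i) := by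
  intro x
  rw [Pi.one_apply, one_smul]
  rcases eq_bit_or_eq_one_add_bit x with rfl | rfl | ⟨j, rfl⟩ | ⟨j, rfl⟩
  · rw [graphVec_zero, zero_add, graphVec_bit]
  · rw [h.graphVec_one, h.graphVec_one_add_bit, ← h.B_A_self_apply i,
      (h.dichotomic_B i).apply_apply]
  · rcases eq_or_ne i j with rfl | hij
    · rw [graphVec_bit, (h.dichotomic_B i).apply_apply, show bit i + bit i = 0 by decide +revert,
        graphVec_zero]
    · obtain ⟨k, hd⟩ := exists_distinct hij
      rw [graphVec_bit, h.B_B_apply hd, bit_add_bit hd.swap, h.graphVec_one_add_bit]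
  · rcases eq_or_ne i j with rfl | hij
    · rw [h.graphVec_one_add_bit, h.B_A_self_apply, show 1 + bit i + bit i = 1 by decide +revert,
        h.graphVec_one]
    · obtain ⟨k, hd⟩ := exists_distinct hij
      rw [h.graphVec_one_add_bit, h.B_A_apply hd,
        show 1 + bit j + bit i = bit k by revert i j k; decide, graphVec_bit]

theorem M_A_apply (h : PerfectlyCorrelated A B M ψ) {i j : Fin 3} (hij : i ≠ j) (l : Fin 3) :
    M i j (A l ψ) = -(bitSign (bit l i) * bitSign (bit l j)) • B l ψ := by
  rcases eq_or_ne l i with rfl | hli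
  · simp [h.M_A_left_apply hij, bitSign, hij.symm]
  rcases eq_or_ne l j with rfl | hlj
  · simp [h.M_A_right_apply hij, bitSign, hij]
  · simp [h.M_A_third_apply ⟨hij, hlj.symm, hli⟩, bitSign, hli.symm, hlj.symm]

theorem signedShift_M (h : PerfectlyCorrelated A B M ψ) {i j : Fin 3} (hij : i ≠ j) :
    SignedShift (M i j) (graphVec B ψ) (fun x => -(bitSign (x i) * bitSign (x j))) 1 := by
  intro x
  rcases eq_bit_or_eq_one_add_bit x with rfl | rfl | ⟨l, rfl⟩ | ⟨l, rfl⟩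
  · rw [graphVec_zero, zero_add, h.graphVec_one, h.M_apply hij]
    simp [bitSign]
  · rw [h.graphVec_one, ← h.M_apply hij, map_neg, (h.dichotomic_M hij).apply_apply,
      show (1 + 1 : Fin 3 → Fin 2) = 0 by decide, graphVec_zero]
    simp [bitSign]
  · rw [graphVec_bit, (h.dichotomic_M hij).apply_eq_iff, add_comm, h.graphVec_one_add_bit,
      Units.smul_def, map_zsmul, h.M_A_apply hij, ← Units.smul_def, smul_smul, Int.units_mul_self,
      one_smul]
  · dsimp only
    have sign_eq : bitSign ((1 + bit l) i) * bitSign ((1 + bit l) j)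
        = bitSign (bit l i) * bitSign (bit l j) := by decide +revert
    rw [h.graphVec_one_add_bit, sign_eq, show 1 + bit l + 1 = bit l by decide +revert,
      graphVec_bit, h.M_A_apply hij]

theorem graphAction (h : PerfectlyCorrelated A B M ψ) : GraphAction A B M (graphVec B ψ) where
  A_shift := h.signedShift_A
  B_shift := h.signedShift_B
  M_shift := h.signedShift_M

theorem V₃_eq_span (h : PerfectlyCorrelated A B M ψ) :
    V₃ A B ψ = Submodule.span ℂ (Set.range (graphVec B ψ)) := by
  apply le_antisymm
  · have hmem (x : Fin 3 → Fin 2) :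
        graphVec B ψ x ∈ Submodule.span ℂ (Set.range (graphVec B ψ)) :=
      Submodule.subset_span ⟨x, rfl⟩
    have hψ := graphVec_zero B ψ ▸ hmem 0
    have hA (i : Fin 3) := h.graphVec_one_add_bit i ▸ hmem (1 + bit i)
    have hB (i : Fin 3) := graphVec_bit B ψ i ▸ hmem (bit i)
    have hAB := hmem 1
    rw [h.graphVec_one, neg_mem_iff, ← h.A_B_self_apply 0] at hAB
    rw [V₃, Submodule.span_le, Set.range_subset_iff]
    simp [Fin.forall_fin_succ, hψ, hA, hB, hAB]
  · rw [Submodule.span_le]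
    rintro _ ⟨x, rfl⟩
    have hmem (m : Fin 8) : ![ψ, A 0 ψ, A 1 ψ, A 2 ψ, B 0 ψ, B 1 ψ, B 2 ψ, A 0 (B 0 ψ)] m ∈
        V₃ A B ψ :=
      Submodule.subset_span ⟨m, rfl⟩
    rcases eq_bit_or_eq_one_add_bit x with rfl | rfl | ⟨l, rfl⟩ | ⟨l, rfl⟩
    · rw [graphVec_zero]
      exact hmem 0
    · rw [h.graphVec_one, ← h.A_B_self_apply 0]
      exact neg_mem (hmem 7)
    · rw [graphVec_bit]
      fin_cases l
      exacts [hmem 4, hmem 5, hmem 6]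
    · rw [h.graphVec_one_add_bit]
      fin_cases l
      exacts [hmem 1, hmem 2, hmem 3]

end PerfectlyCorrelated

end GraphBasis

section ThreeQubits

theorem tensorOp_mul (σ τ : Fin 3 → Matrix (Fin 2) (Fin 2) ℂ) :
    tensorOp σ * tensorOp τ = tensorOp fun l => σ l * τ l := by
  rw [tensorOp, tensorOp, ← map_mul, tensorOp]
  congr 1
  ext x y
  simp only [Matrix.mul_apply, Matrix.of_apply, ← Finset.prod_mul_distrib, Finset.prod_univ_sum,
    Fintype.piFinset_univ]

theorem tensorOp_one : tensorOp (fun _ => 1) = 1 := by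
  rw [tensorOp, ← map_one (Matrix.toEuclideanCLM (𝕜 := ℂ) (n := Fin 3 → Fin 2))]
  congr 1
  ext x y
  simp [Matrix.one_apply, Finset.prod_ite_zero, funext_iff]

theorem isDichotomic_tensorOp {σ : Fin 3 → Matrix (Fin 2) (Fin 2) ℂ}
    (hherm : ∀ l, (σ l).IsHermitian) (hsq : ∀ l, σ l * σ l = 1) : IsDichotomic (tensorOp σ) := by
  refine ⟨?_, ?_⟩
  · rw [IsSelfAdjoint, tensorOp, ← map_star]
    congr 1
    ext x y
    simp only [Matrix.star_apply, Matrix.of_apply, star_prod, (hherm _).apply]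
  · simp only [tensorOp_mul, hsq, tensorOp_one]

theorem tensorOp_apply_of_monomial {σ : Fin 3 → Matrix (Fin 2) (Fin 2) ℂ} {c : Fin 3 → Fin 2 → ℤˣ}
    {t : Fin 3 → Fin 2} (hσ : ∀ l a b, σ l a b = if a + t l = b then ((c l a : ℤ) : ℂ) else 0)
    (φ : ThreeQubits) (x : Fin 3 → Fin 2) :
    tensorOp σ φ x = (∏ l, c l (x l)) • φ (x + t) := by
  have entry (y : Fin 3 → Fin 2) : ∏ l, σ l (x l) (y l)
      = if x + t = y then ((∏ l, c l (x l) : ℤˣ) : ℂ) else 0 := by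
    simp [hσ, Finset.prod_ite_zero, funext_iff]
  simp [tensorOp, Matrix.mulVec, dotProduct, entry, Units.smul_def]

theorem isDichotomic_X (i : Fin 3) : IsDichotomic (X i) := by
  have hherm : pauliX.IsHermitian := by ext a b; fin_cases a <;> fin_cases b <;> simp [pauliX]
  have hsq : pauliX * pauliX = 1 := by simp [pauliX, Matrix.one_fin_two]
  refine isDichotomic_tensorOp (fun l => ?_) fun l => ?_ <;> split_ifs
  exacts [hherm, Matrix.isHermitian_one, hsq, one_mul 1]

theorem isDichotomic_Z (i : Fin 3) : IsDichotomic (Z i) := by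
  have hherm : pauliZ.IsHermitian := by ext a b; fin_cases a <;> fin_cases b <;> simp [pauliZ]
  have hsq : pauliZ * pauliZ = 1 := by simp [pauliZ, Matrix.one_fin_two]
  refine isDichotomic_tensorOp (fun l => ?_) fun l => ?_ <;> split_ifs
  exacts [hherm, Matrix.isHermitian_one, hsq, one_mul 1]

theorem XXZ_eq_mul {i j k : Fin 3} (hd : Distinct i j k) : XXZ i j = X i * X j * Z k := by
  simp only [XXZ, X, Z, tensorOp_mul]
  congr 1
  funext l
  obtain rfl | rfl | rfl : l = i ∨ l = j ∨ l = k := by omega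
  · simp [hd.1, hd.2.2.symm]
  · simp [hd.1.symm, hd.2.1]
  · simp [hd.2.1.symm, hd.2.2]

theorem X_apply (i : Fin 3) (φ : ThreeQubits) (x : Fin 3 → Fin 2) :
    X i φ x = φ (x + bit i) := by
  have entry (l : Fin 3) (a b : Fin 2) : (if l = i then pauliX else 1) a b
      = if a + bit i l = b then (((1 : ℤˣ) : ℤ) : ℂ) else 0 := by
    rcases eq_or_ne l i with rfl | hl
    · fin_cases a <;> fin_cases b <;> simp [pauliX]
    · simp [hl, Matrix.one_apply]
  simpa [X] using tensorOp_apply_of_monomial (c := fun _ _ => 1) entry φ x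

theorem Z_apply (i : Fin 3) (φ : ThreeQubits) (x : Fin 3 → Fin 2) :
    Z i φ x = bitSign (x i) • φ x := by
  have entry (l : Fin 3) (a b : Fin 2) : (if l = i then pauliZ else 1) a b
      = if a + 0 = b then (((if l = i then bitSign a else 1 : ℤˣ) : ℤ) : ℂ) else 0 := by
    rcases eq_or_ne l i with rfl | hl
    · fin_cases a <;> fin_cases b <;> simp [pauliZ, bitSign]
    · simp [hl, Matrix.one_apply]
  simpa [Z] using tensorOp_apply_of_monomial (t := 0)
    (c := fun l a => if l = i then bitSign a else 1) entry φ x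

/-- The bicharacter `(-1) ^ (x ⬝ y)` of bit strings. -/
def pairing (x y : Fin 3 → Fin 2) : ℤˣ := ∏ l, bitSign (x l * y l)

theorem bitSign_add (a b : Fin 2) : bitSign (a + b) = bitSign a * bitSign b := by
  decide +revert

theorem pairing_add_left (x x' y : Fin 3 → Fin 2) :
    pairing (x + x') y = pairing x y * pairing x' y := by
  simp [pairing, add_mul, bitSign_add, Finset.prod_mul_distrib]

theorem pairing_add_right (x y y' : Fin 3 → Fin 2) :
    pairing x (y + y') = pairing x y * pairing x y' := by
  simp [pairing, mul_add, bitSign_add, Finset.prod_mul_distrib]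

theorem pairing_bit_left (i : Fin 3) (y : Fin 3 → Fin 2) : pairing (bit i) y = bitSign (y i) := by
  decide +revert

theorem pairing_bit_right (x : Fin 3 → Fin 2) (i : Fin 3) : pairing x (bit i) = bitSign (x i) := by
  decide +revert

/-- The signs of the amplitudes of the complete-graph state: the exponent has a term `x i * x j` for
each edge of the triangle. -/
def graphSign (x : Fin 3 → Fin 2) : ℤˣ := bitSign (x 0 * x 1 + x 1 * x 2 + x 2 * x 0)

theorem graphSign_add_bit (x : Fin 3 → Fin 2) (i : Fin 3) :
    graphSign (x + bit i) = pairing (1 + bit i) x * graphSign x := by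
  decide +revert

theorem G₃_apply (x : Fin 3 → Fin 2) :
    G₃ x = graphSign x • ((1 / Real.sqrt 8 : ℝ) : ℂ) := by
  obtain ⟨a, b, c, rfl⟩ : ∃ a b c, x = ![a, b, c] :=
    ⟨x 0, x 1, x 2, by ext l; fin_cases l <;> rfl⟩
  fin_cases a <;> fin_cases b <;> fin_cases c <;> simp [G₃, ket, graphSign, bitSign]

theorem norm_G₃ : ‖G₃‖ = 1 := by
  have norm_sq_amplitude (x : Fin 3 → Fin 2) : ‖G₃ x‖ ^ 2 = 1 / 8 := by
    rcases Int.units_eq_one_or (graphSign x) with hx | hx <;> simp [G₃_apply, hx]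
  simp [EuclideanSpace.norm_eq, norm_sq_amplitude]

/-- The basis of three qubits obtained from the complete-graph state by applying `Z` to the qubits
`l` with `x l = 1`. -/
noncomputable def graphStateVec (x : Fin 3 → Fin 2) : ThreeQubits :=
  WithLp.toLp 2 fun y => pairing x y • G₃ y

theorem graphStateVec_zero : graphStateVec 0 = G₃ := by
  ext y
  simp [graphStateVec, pairing, bitSign]

theorem signedShift_X (i : Fin 3) :
    SignedShift (X i) graphStateVec (fun x => bitSign (x i)) (1 + bit i) := by
  intro x
  ext y
  have hsign : pairing x (y + bit i) * graphSign (y + bit i)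
      = bitSign (x i) * (pairing (x + (1 + bit i)) y * graphSign y) := by
    rw [pairing_add_right, pairing_bit_right, graphSign_add_bit,
      pairing_add_left x (1 + bit i) y]
    ac_rfl
  change X i (graphStateVec x) y = bitSign (x i) • graphStateVec (x + (1 + bit i)) y
  simp only [X_apply, graphStateVec, G₃_apply, smul_smul, hsign]

theorem signedShift_Z (i : Fin 3) : SignedShift (Z i) graphStateVec 1 (bit i) := by
  intro x
  ext y
  simp [Z_apply, graphStateVec, pairing_add_left, pairing_bit_left, smul_smul, mul_comm]

theorem signedShift_XXZ {i j : Fin 3} (hij : i ≠ j) :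
    SignedShift (XXZ i j) graphStateVec (fun x => -(bitSign (x i) * bitSign (x j))) 1 := by
  obtain ⟨k, hd⟩ := exists_distinct hij
  have hindex : bit k + (1 + bit j + (1 + bit i)) = 1 := by
    clear hij; revert i j k; decide
  have hsign (x : Fin 3 → Fin 2) : -(bitSign (x i) * bitSign (x j))
      = bitSign ((x + bit k) j) * bitSign ((x + bit k + (1 + bit j)) i) := by
    clear hij hindex; revert i j k x; decide
  have hshift := ((signedShift_X i).mul (signedShift_X j)).mul (signedShift_Z k)
  rw [← XXZ_eq_mul hd, hindex] at hshift
  simpa only [hsign, Pi.one_apply, one_mul] using hshift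

theorem graphAction_graphStateVec : GraphAction X Z XXZ graphStateVec where
  A_shift := signedShift_X
  B_shift := signedShift_Z
  M_shift := signedShift_XXZ

theorem orthonormal_graphStateVec : Orthonormal ℂ graphStateVec :=
  graphAction_graphStateVec.orthonormal isDichotomic_X isDichotomic_Z
    (by rw [graphStateVec_zero, norm_G₃])

end ThreeQubits

section Unitary

variable {H : Type*} [NormedAddCommGroup H] [InnerProductSpace ℂ H]

theorem exists_orthonormalBasis_of_eq_span {ι : Type*} [Fintype ι] {v : ι → H}
    (hv : Orthonormal ℂ v) {V : Submodule ℂ H} (hV : V = Submodule.span ℂ (Set.range v)) :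
    ∃ b : OrthonormalBasis ι ℂ V, ∀ x, (b x : H) = v x := by
  have hmem (x : ι) : v x ∈ V := hV ▸ Submodule.subset_span ⟨x, rfl⟩
  have horth : Orthonormal ℂ fun x => (⟨v x, hmem x⟩ : V) :=
    V.subtypeₗᵢ.orthonormal_comp_iff.1 hv
  exact ⟨.mk horth ((V.span_range_subtype_eq_top_iff hmem).2 hV.symm).ge, by simp⟩

theorem exists_orthonormalBasis_graphStateVec :
    ∃ b : OrthonormalBasis (Fin 3 → Fin 2) ℂ ThreeQubits, ⇑b = graphStateVec :=
  ⟨.mk orthonormal_graphStateVec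
    (orthonormal_graphStateVec.linearIndependent.span_eq_top_of_card_eq_finrank' (by simp)).ge,
    by simp⟩

end Unitary

end TemporalSelfTest

open TemporalSelfTest in
theorem theorem1 {H : Type*} [NormedAddCommGroup H] [InnerProductSpace ℂ H] [CompleteSpace H]
    (π₄ : Fin 3 → OrderSet 4) (π₃ : Fin 4 → OrderSet 3) (π₂ : Fin 3 → OrderSet 2)
    (ψ : H) (hψ : ‖ψ‖ = 1)
    (A B : Fin 3 → (H →L[ℂ] H)) (M : Fin 3 → Fin 3 → (H →L[ℂ] H))
    (hA : ∀ i, IsDichotomic (A i)) (hB : ∀ i, IsDichotomic (B i))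
    (hM : ∀ i j, i ≠ j → IsDichotomic (M i j)) (hMsymm : ∀ i j, M i j = M j i)
    (hmax : T₃ π₄ π₃ π₂ A B M ψ = 10) :
    Module.finrank ℂ (V₃ A B ψ) = 8 ∧
    (∀ i, ∀ v ∈ V₃ A B ψ, A i v ∈ V₃ A B ψ) ∧
    (∀ i, ∀ v ∈ V₃ A B ψ, B i v ∈ V₃ A B ψ) ∧
    (∀ i j, i ≠ j → ∀ v ∈ V₃ A B ψ, M i j v ∈ V₃ A B ψ) ∧
    ∃ U : V₃ A B ψ ≃ₗᵢ[ℂ] ThreeQubits,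
      (∀ i φ, U (compress (V₃ A B ψ) (A i) (U.symm φ)) = X i φ) ∧
      (∀ i φ, U (compress (V₃ A B ψ) (B i) (U.symm φ)) = Z i φ) ∧
      (∀ i j, i ≠ j → ∀ φ, U (compress (V₃ A B ψ) (M i j) (U.symm φ)) = XXZ i j φ) ∧
      U ((V₃ A B ψ).orthogonalProjectionOnto ψ) = G₃ := by
  have hcorr := perfectlyCorrelated_of_T₃_eq hψ hA hB hM hMsymm hmax
  have hact := hcorr.graphAction
  have hspan := hcorr.V₃_eq_span
  have horth := hact.orthonormal hA hB (by rw [graphVec_zero, hψ])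
  obtain ⟨b, hb⟩ := exists_orthonormalBasis_of_eq_span horth hspan
  obtain ⟨b', hb'⟩ := exists_orthonormalBasis_graphStateVec
  have hmodel := graphAction_graphStateVec
  rw [← funext hb] at hact
  rw [← hb'] at hmodel
  have hinv {T : H →L[ℂ] H} {ε t} (hT : SignedShift T (graphVec B ψ) ε t) :
      ∀ v ∈ V₃ A B ψ, T v ∈ V₃ A B ψ := by
    rw [hspan]; exact fun v hv => hT.apply_mem_span hv
  have hproj := (V₃ A B ψ).orthogonalProjectionOnto_mem_subspace_eq_self (b 0)
  rw [hb, graphVec_zero] at hproj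
  refine ⟨by simpa using Module.finrank_eq_card_basis b.toBasis,
    fun i => hinv (hcorr.signedShift_A i), fun i => hinv (hcorr.signedShift_B i),
    fun i j hij => hinv (hcorr.signedShift_M hij), b.equiv b' (.refl _),
    fun i => (hact.A_shift i).equiv_compress_apply b b' (hmodel.A_shift i),
    fun i => (hact.B_shift i).equiv_compress_apply b b' (hmodel.B_shift i),
    fun i j hij => (hact.M_shift hij).equiv_compress_apply b b' (hmodel.M_shift hij), ?_⟩
  simp [hproj, hb', graphStateVec_zero]
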